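/- For $\theta\in\mathbb R$ let $$\mathbf{Bad}_\theta(1,1)=\Big\{x\in\mathbb R \;:\; \exists\, c>0 \text{ such that } \inf_{p\in\mathbb Z}|\theta q-x-p|\ge \frac{c}{|q|}\ \text{ for all } q\in\mathbb Z\setminus\{0\}\Big\}.$$ For $0<\alpha,\beta<1$ and $S\subset\mathbb R$, the $(\alpha,\beta)$-game is played by Black and White, who alternately choose nested closed balls $B_1\supset W_1\supset B_2\supset W_2\supset\cdots$ in $\mathbb R$; $B_1$ is an arbitrary closed ball of positive radius, the radius of $W_n$ is $\alpha$ times that of $B_n$, and the radius of $B_{n+1}$ is $\beta$ times that of $W_n$. White wins if the intersection of all these balls lies in $S$. The set $S$ is called $\alpha$-winning if, for every $\beta\in(0,1)$, White has a winning strategy in the $(\alpha,\beta)$-game. Corollary 2. Let $\{\theta_n\}$ be any countable family of real numbers and $\{f_m\}$ any countable family of invertible affine maps $\mathbb R\to\mathbb R$. Then the set $$\bigcap_{m}\bigcap_{n} f_m\big(\mathbf{Bad}_{\theta_n}(1,1)\big)$$ is $1/8$-winning, and it has full Hausdorff dimension, that is, Hausdorff dimension $1$. -/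

import Mathlib

/-- The distance `‖x‖_ℤ = inf_{p ∈ ℤ} |x - p|` from a real number to the integers. -/
noncomputable def distToInt (x : ℝ) : ℝ := ⨅ p : ℤ, |x - (p : ℝ)|

/-- `Bad_θ(1,1)`: the reals `x` for which there is `c > 0` with `‖θ q - x‖_ℤ ≥ c / |q|` for all
nonzero integers `q`. -/
def BadOneOne (θ : ℝ) : Set ℝ :=
  {x | ∃ c : ℝ, 0 < c ∧ ∀ q : ℤ, q ≠ 0 → c / |(q : ℝ)| ≤ distToInt (θ * (q : ℝ) - x)}

namespace SchmidtGame

/-- A ball of the game: a centre together with a positive radius. -/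
structure GameBall (M : Type*) where
  center : M
  radius : ℝ
  radius_pos : 0 < radius

variable {M : Type*} [MetricSpace M]

/-- The closed ball, as a set of points. -/
def GameBall.toSet (B : GameBall M) : Set M := Metric.closedBall B.center B.radius

/-- `B'` is an admissible answer to `B` with ratio `r`: it lies inside `B` and its radius is `r`
times the radius of `B`. -/
def IsAnswer (r : ℝ) (B B' : GameBall M) : Prop :=
  B'.toSet ⊆ B.toSet ∧ B'.radius = r * B.radius

/-- A strategy for White: given Black's first `n + 1` balls `B 0, …, B n`, it names White's ball
`W n`. (White's own earlier balls are determined by the strategy and Black's balls.) -/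
def WhiteStrategy (M : Type*) : Type _ := (n : ℕ) → (Fin (n + 1) → GameBall M) → GameBall M

/-- White's `n`-th ball when White follows `σ` and Black plays `B`. -/
def WhiteStrategy.play (σ : WhiteStrategy M) (B : ℕ → GameBall M) (n : ℕ) : GameBall M :=
  σ n (fun i => B i)

/-- Black's moves `B 0, …, B n` obey the rules against a White player following `σ`
(`B 0` is arbitrary). -/
def BlackLegalUpTo (β : ℝ) (σ : WhiteStrategy M) (B : ℕ → GameBall M) (n : ℕ) : Prop :=
  ∀ k < n, IsAnswer β (σ.play B k) (B (k + 1))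

/-- `σ` is a winning strategy for White in the `(α, β)`-game with target `S`: as long as Black has
obeyed the rules White's next move obeys them, and whenever Black obeys the rules throughout, the
intersection of all the balls lies in `S`. -/
def IsWinningStrategy (α β : ℝ) (S : Set M) (σ : WhiteStrategy M) : Prop :=
  ∀ B : ℕ → GameBall M,
    (∀ n, BlackLegalUpTo β σ B n → IsAnswer α (B n) (σ.play B n)) ∧
    ((∀ n, BlackLegalUpTo β σ B n) → (⋂ n, (B n).toSet ∩ (σ.play B n).toSet) ⊆ S)

/-- `S` is `(α, β)`-winning. -/
def IsAlphaBetaWinning (α β : ℝ) (S : Set M) : Prop :=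
  ∃ σ : WhiteStrategy M, IsWinningStrategy α β S σ

/-- `S` is `α`-winning: it is `(α, β)`-winning for every `0 < β < 1`. -/
def IsAlphaWinning (α : ℝ) (S : Set M) : Prop :=
  ∀ β : ℝ, 0 < β → β < 1 → IsAlphaBetaWinning α β S

end SchmidtGame

/-- The least positive integer `q` with `‖q θ‖ < 1 / T`. -/
noncomputable def dirichletDenom (θ T : ℝ) : ℕ :=
  sInf {q : ℕ | 0 < q ∧ ∃ p : ℤ, |(q : ℝ) * θ - p| < 1 / T}

theorem exists_nat_le_abs_mul_sub_lt (θ : ℝ) {T : ℝ} (hT : 1 ≤ T) :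
    ∃ q : ℕ, 0 < q ∧ (q : ℝ) ≤ T ∧ ∃ p : ℤ, |(q : ℝ) * θ - p| < 1 / T := by
  obtain ⟨q, hq, hqT, h⟩ :=
    Real.exists_nat_abs_mul_sub_round_le θ (Nat.floor_pos.mpr hT)
  refine ⟨q, hq, ?_, round ((q : ℝ) * θ), h.trans_lt ?_⟩
  · exact (Nat.cast_le.mpr hqT).trans (Nat.floor_le (by linarith))
  · exact one_div_lt_one_div_of_lt (by linarith) (Nat.lt_floor_add_one T)

theorem dirichletDenom_spec (θ : ℝ) {T : ℝ} (hT : 1 ≤ T) :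
    0 < dirichletDenom θ T ∧ ∃ p : ℤ, |(dirichletDenom θ T : ℝ) * θ - p| < 1 / T := by
  obtain ⟨q, hq, -, h⟩ := exists_nat_le_abs_mul_sub_lt θ hT
  exact Nat.sInf_mem (s := {q : ℕ | 0 < q ∧ ∃ p : ℤ, |(q : ℝ) * θ - p| < 1 / T}) ⟨q, hq, h⟩

theorem dirichletDenom_le (θ : ℝ) {T : ℝ} (hT : 1 ≤ T) : (dirichletDenom θ T : ℝ) ≤ T := by
  obtain ⟨q, hq, hqT, h⟩ := exists_nat_le_abs_mul_sub_lt θ hT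
  have hle : dirichletDenom θ T ≤ q := Nat.sInf_le ⟨hq, h⟩
  exact (Nat.cast_le.mpr hle).trans hqT

/-- When the minimal denominator changes between the scales `T` and `U`, the new one is
comparable to `T`. -/
theorem le_two_mul_dirichletDenom_of_ne (θ : ℝ) {T U : ℝ} (hT : 1 ≤ T) (hTU : T ≤ U)
    (hne : dirichletDenom θ U ≠ dirichletDenom θ T) : T ≤ 2 * dirichletDenom θ U := by
  obtain ⟨hq, P, hP⟩ := dirichletDenom_spec θ hT
  obtain ⟨hq', P', hP'⟩ := dirichletDenom_spec θ (hT.trans hTU)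
  have hUT : 1 / U ≤ 1 / T := one_div_le_one_div_of_le (by linarith) hTU
  have hle : dirichletDenom θ T ≤ dirichletDenom θ U :=
    Nat.sInf_le ⟨hq', P', hP'.trans_le hUT⟩
  have hnot : ∀ p : ℤ, 1 / U ≤ |(dirichletDenom θ T : ℝ) * θ - p| := by
    intro p
    by_contra! hp
    exact hne (le_antisymm (Nat.sInf_le ⟨hq, p, hp⟩) hle)
  generalize dirichletDenom θ T = q at *
  generalize dirichletDenom θ U = q' at *
  have hqr : (0 : ℝ) < q := by exact_mod_cast hq
  have hqr' : (0 : ℝ) < q' := by exact_mod_cast hq'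
  have hler : (q : ℝ) ≤ q' := by exact_mod_cast hle
  have hid : (q : ℝ) * P' - q' * P = q' * (q * θ - P) - q * (q' * θ - P') := by ring
  by_cases hD : (q : ℤ) * P' - q' * P = 0
  · exfalso
    have hDr : (q : ℝ) * P' - q' * P = 0 := by exact_mod_cast hD
    have h1 : (q' : ℝ) * |q * θ - P| = q * |q' * θ - P'| := by
      have h := congrArg abs (sub_eq_zero.mp (hid.symm.trans hDr))
      rwa [abs_mul, abs_mul, abs_of_pos hqr, abs_of_pos hqr'] at h
    have h2 : (q : ℝ) * |q' * θ - P'| < q' * (1 / U) :=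
      (mul_le_mul_of_nonneg_right hler (abs_nonneg _)).trans_lt
        (mul_lt_mul_of_pos_left hP' hqr')
    rw [← h1] at h2
    exact absurd (lt_of_mul_lt_mul_left h2 hqr'.le) (not_lt.mpr (hnot P))
  · have h1 : (1 : ℝ) ≤ |(q : ℝ) * P' - q' * P| := by
      exact_mod_cast Int.one_le_abs hD
    have h2 : |(q : ℝ) * P' - q' * P| ≤ q' * (1 / T) + q' * (1 / T) := by
      rw [hid]
      refine (abs_sub _ _).trans ?_
      rw [abs_mul, abs_mul, abs_of_pos hqr, abs_of_pos hqr']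
      gcongr
      exact hP'.le.trans hUT
    have h3 : (1 : ℝ) ≤ 2 * q' / T := by
      calc (1 : ℝ) ≤ _ := h1.trans h2
        _ = _ := by ring
    rwa [le_div_iff₀ (by linarith), one_mul] at h3

/-- A point which at geometrically growing scales `T i` keeps distance `1 / (8 T i)` from the
fractions with the minimal denominator of that scale keeps distance `δ / q` from them, where `q`
is this denominator. -/
theorem exists_le_abs_sub_div_dirichletDenom {θ y R : ℝ} {T : ℕ → ℝ} (hR : 1 ≤ R)
    (hT0 : 1 ≤ T 0) (hT : ∀ i, T (i + 1) = R * T i)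
    (hy : ∀ i, ∀ p : ℤ, 1 / (8 * T i) ≤ |y - p / dirichletDenom θ (T i)|) :
    ∃ δ : ℝ, 0 < δ ∧ ∀ i, ∀ p : ℤ,
      δ / dirichletDenom θ (T i) ≤ |y - p / dirichletDenom θ (T i)| := by
  have hT1 : ∀ i, 1 ≤ T i := by
    intro i
    induction i with
    | zero => exact hT0
    | succ i ih => rw [hT]; nlinarith
  have hT0p : 0 < T 0 := by linarith
  have hRp : 0 < R := by linarith
  refine ⟨min (1 / (8 * T 0)) (1 / (16 * R)), by positivity, fun i => ?_⟩
  induction i with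
  | zero =>
    intro p
    have hq : (1 : ℝ) ≤ dirichletDenom θ (T 0) := by
      exact_mod_cast (dirichletDenom_spec θ hT0).1
    exact ((div_le_self (by positivity) hq).trans (min_le_left _ _)).trans (hy 0 p)
  | succ i ih =>
    by_cases hne : dirichletDenom θ (T (i + 1)) = dirichletDenom θ (T i)
    · rwa [hne]
    · intro p
      have hTi := hT1 i
      have hle : T i ≤ T (i + 1) := by rw [hT]; nlinarith
      have h := le_two_mul_dirichletDenom_of_ne θ (hT1 i) hle hne
      have hq : (0 : ℝ) < dirichletDenom θ (T (i + 1)) := by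
        exact_mod_cast (dirichletDenom_spec θ (hT1 (i + 1))).1
      refine le_trans ?_ (hy (i + 1) p)
      calc _ ≤ 1 / (16 * R) / dirichletDenom θ (T (i + 1)) := by
            gcongr
            exact min_le_right _ _
        _ = 1 / (8 * R * (2 * dirichletDenom θ (T (i + 1)))) := by
            field_simp; norm_num
        _ ≤ 1 / (8 * R * T i) := by gcongr
        _ = 1 / (8 * T (i + 1)) := by rw [hT, mul_assoc]

theorem mem_badOneOne_of_le_abs_sub_div {θ y R : ℝ} {T : ℕ → ℝ} (hR : 1 < R)
    (hT0 : 1 ≤ T 0) (hT : ∀ i, T (i + 1) = R * T i)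
    (hy : ∀ i, ∀ p : ℤ, 1 / (8 * T i) ≤ |y - p / dirichletDenom θ (T i)|) :
    y ∈ BadOneOne θ := by
  obtain ⟨δ, hδ, h⟩ := exists_le_abs_sub_div_dirichletDenom hR.le hT0 hT hy
  have hTpow : ∀ i, T i = R ^ i * T 0 := by
    intro i
    induction i with
    | zero => simp
    | succ i ih => rw [hT, ih]; ring
  have hRp : 0 < R := by linarith
  have hT0p : 0 < T 0 := by linarith
  have hT1 : ∀ i, 1 ≤ T i := fun i => by
    rw [hTpow]
    exact one_le_mul_of_one_le_of_one_le (one_le_pow₀ hR.le) hT0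
  have key : ∀ i, ∀ m p : ℤ, |(m : ℝ)| ≤ δ / 2 * T i → δ / 2 / T i ≤ |θ * m - y - p| := by
    intro i m p hm
    have hTi : 0 < T i := by linarith [hT1 i]
    obtain ⟨hq, P, hP⟩ := dirichletDenom_spec θ (hT1 i)
    have hqT := dirichletDenom_le θ (hT1 i)
    have hd := h i (P * m - p * dirichletDenom θ (T i))
    generalize dirichletDenom θ (T i) = q at *
    have hqr : (0 : ℝ) < q := by exact_mod_cast hq
    have e1 : |θ * m - P * m / q| ≤ δ / 2 / q := by
      have : θ * m - P * m / q = (q * θ - P) * m / q := by field_simp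
      rw [this, abs_div, abs_mul, abs_of_pos hqr]
      gcongr
      calc _ ≤ 1 / T i * (δ / 2 * T i) := by gcongr
        _ = δ / 2 := by field_simp
    have e2 : y - ((P * m - p * q : ℤ) : ℝ) / q = y - (P * m / q - p) := by
      push_cast; field_simp
    rw [e2] at hd
    have e3 : |y - (P * m / q - p)| ≤ |θ * m - y - p| + |θ * m - P * m / q| := by
      have := abs_sub (θ * m - P * m / q) (θ * m - y - p)
      rw [show θ * m - P * m / q - (θ * m - y - p) = y - (P * m / q - p) by ring] at this
      linarith
    have e4 : δ / q = δ / 2 / q + δ / 2 / q := by ring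
    have e5 : δ / 2 / T i ≤ δ / 2 / q := by gcongr
    linarith
  refine ⟨min (δ / 2 / T 0) (δ / 2 * (δ / 2) / R), by positivity, fun m hm => ?_⟩
  have hm1 : (1 : ℝ) ≤ |(m : ℝ)| := by exact_mod_cast Int.one_le_abs hm
  have hm0 : 0 < |(m : ℝ)| := by linarith
  have hex : ∃ i, |(m : ℝ)| ≤ δ / 2 * T i := by
    obtain ⟨i, hi⟩ := pow_unbounded_of_one_lt (|(m : ℝ)| / (δ / 2)) hR
    refine ⟨i, ?_⟩
    rw [div_lt_iff₀ (by positivity)] at hi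
    rw [hTpow]
    have : R ^ i ≤ R ^ i * T 0 := le_mul_of_one_le_right (by positivity) hT0
    nlinarith
  classical
  have hi := Nat.find_spec hex
  have hmin := fun j => Nat.find_min hex (m := j)
  refine le_ciInf fun p => ?_
  generalize Nat.find hex = i at hi hmin
  refine le_trans ?_ (key i m p hi)
  rcases i with _ | i
  · exact (div_le_self (by positivity) hm1).trans (min_le_left _ _)
  · have hlt := not_le.mp (hmin i i.lt_succ_self)
    have hTi : 0 < T i := by linarith [hT1 i]
    calc _ ≤ δ / 2 * (δ / 2) / R / |(m : ℝ)| := by gcongr; exact min_le_right _ _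
      _ ≤ δ / 2 * (δ / 2) / R / (δ / 2 * T i) := by gcongr
      _ = δ / 2 / T (i + 1) := by rw [hT]; field_simp

namespace SchmidtGame

theorem IsAlphaWinning.mono {M : Type*} [MetricSpace M] {α : ℝ} {S S' : Set M}
    (h : IsAlphaWinning α S) (hSS' : S ⊆ S') : IsAlphaWinning α S' := by
  intro β hβ hβ1
  obtain ⟨σ, hσ⟩ := h β hβ hβ1
  exact ⟨σ, fun B => ⟨(hσ B).1, fun hB => ((hσ B).2 hB).trans hSS'⟩⟩

theorem radius_eq_of_legal {M : Type*} [MetricSpace M] {α β : ℝ} {σ : WhiteStrategy M}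
    {B : ℕ → GameBall M} (hW : ∀ n, IsAnswer α (B n) (σ.play B n))
    (hB : ∀ n, IsAnswer β (σ.play B n) (B (n + 1))) (n : ℕ) :
    (B n).radius = (α * β) ^ n * (B 0).radius := by
  induction n with
  | zero => simp
  | succ n ih => rw [(hB n).2, (hW n).2, ih]; ring

/-- White can move away from an arithmetic progression whose step is at least twice the length of
Black's interval. -/
theorem exists_answer_far_from_progression (B : GameBall ℝ) (b s : ℝ)
    (hs : 4 * B.radius ≤ |s|) :
    ∃ W : GameBall ℝ, IsAnswer (1 / 8) B W ∧
      ∀ x ∈ W.toSet, ∀ p : ℤ, B.radius / 2 ≤ |x - (b + p * s)| := by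
  have hr := B.radius_pos
  have hs0 : s ≠ 0 := by
    rintro rfl
    rw [abs_zero] at hs
    linarith
  set p₀ : ℤ := round ((B.center - b) / s) with hp₀
  have hz : |B.center - (b + p₀ * s)| ≤ |s| / 2 := by
    have h := abs_sub_round ((B.center - b) / s)
    have e : B.center - (b + p₀ * s) = ((B.center - b) / s - p₀) * s := by
      field_simp
      ring
    rw [e, abs_mul]
    nlinarith [abs_nonneg s]
  obtain ⟨w, hwc, hwz⟩ : ∃ w : ℝ, |w - B.center| ≤ 7 / 8 * B.radius ∧
      7 / 8 * B.radius ≤ |w - (b + p₀ * s)| := by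
    rcases le_total (b + p₀ * s) B.center with h | h
    · refine ⟨B.center + 7 / 8 * B.radius, ?_, ?_⟩
      · rw [add_sub_cancel_left, abs_of_pos (by positivity)]
      · exact le_trans (by linarith) (le_abs_self _)
    · refine ⟨B.center - 7 / 8 * B.radius, ?_, ?_⟩
      · rw [sub_sub_cancel_left, abs_neg, abs_of_pos (by positivity)]
      · exact le_trans (by linarith) (neg_le_abs _)
  have hin : ∀ x, |x - w| ≤ 1 / 8 * B.radius → |x - B.center| ≤ B.radius := by
    intro x hx
    linarith [abs_sub_le x w B.center]
  refine ⟨⟨w, 1 / 8 * B.radius, by positivity⟩, ⟨fun x hx => hin x hx, rfl⟩, fun x hx p => ?_⟩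
  replace hx : |x - w| ≤ 1 / 8 * B.radius := hx
  by_cases hp : p = p₀
  · rw [hp]
    have := abs_sub_le w x (b + p₀ * s)
    rw [abs_sub_comm w x] at this
    linarith
  · have h1 : |s| ≤ |(b + p₀ * s) - (b + p * s)| := by
      have e : (b + p₀ * s) - (b + p * s) = ((p₀ - p : ℤ) : ℝ) * s := by push_cast; ring
      have h : (1 : ℝ) ≤ |((p₀ - p : ℤ) : ℝ)| := by
        exact_mod_cast Int.one_le_abs (sub_ne_zero.mpr (Ne.symm hp))
      rw [e, abs_mul]
      exact le_mul_of_one_le_left (abs_nonneg s) h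
    have h2 := abs_sub_le (b + p₀ * s) B.center (b + p * s)
    have h3 := abs_sub_le B.center x (b + p * s)
    rw [abs_sub_comm (b + p₀ * s) B.center] at h2
    rw [abs_sub_comm B.center x] at h3
    linarith [hin x hx]

end SchmidtGame

theorem AffineEquiv.real_apply_eq (f : ℝ ≃ᵃ[ℝ] ℝ) (x : ℝ) : f x = f 0 + x * f.linear 1 := by
  have h := f.map_vadd 0 x
  have h' : f.linear x = x * f.linear 1 := by
    rw [← smul_eq_mul, ← map_smul, smul_eq_mul, mul_one]
  simp only [vadd_eq_add, add_zero] at h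
  rw [h, h', add_comm]

theorem AffineEquiv.real_linear_one_ne_zero (f : ℝ ≃ᵃ[ℝ] ℝ) : f.linear 1 ≠ 0 := by
  simp

namespace SchmidtGame

/-- White can move away from the images under `f` of the fractions with the minimal denominator
belonging to the scale of Black's ball. -/
theorem exists_answer_far_from_fractions (θ : ℝ) (f : ℝ ≃ᵃ[ℝ] ℝ) (B : GameBall ℝ) :
    ∃ W : GameBall ℝ, IsAnswer (1 / 8) B W ∧ (4 * B.radius ≤ |f.linear 1| →
      ∀ x ∈ W.toSet, ∀ p : ℤ, B.radius / 2 ≤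
        |x - f (p / dirichletDenom θ (|f.linear 1| / (4 * B.radius)))|) := by
  have hr := B.radius_pos
  by_cases h : 4 * B.radius ≤ |f.linear 1|
  · have hT : 1 ≤ |f.linear 1| / (4 * B.radius) := by
      rwa [le_div_iff₀ (by positivity), one_mul]
    have hq := (dirichletDenom_spec θ hT).1
    have hqT := dirichletDenom_le θ hT
    generalize dirichletDenom θ (|f.linear 1| / (4 * B.radius)) = q at *
    have hqr : (0 : ℝ) < q := by exact_mod_cast hq
    obtain ⟨W, hW, hWx⟩ := exists_answer_far_from_progression B (f 0) (f.linear 1 / q) (by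
      rw [abs_div, abs_of_pos hqr, le_div_iff₀ hqr]
      rw [le_div_iff₀ (by positivity)] at hqT
      linarith)
    refine ⟨W, hW, fun _ x hx p => ?_⟩
    rw [f.real_apply_eq, show (p : ℝ) / q * f.linear 1 = p * (f.linear 1 / q) by ring]
    exact hWx x hx p
  · obtain ⟨W, hW, -⟩ := exists_answer_far_from_progression B 0 (4 * B.radius) (le_abs_self _)
    exact ⟨W, hW, fun h' => absurd h' h⟩

theorem padicValNat_two_progression (j i : ℕ) :
    padicValNat 2 (2 ^ j - 1 + 2 ^ (j + 1) * i + 1) = j := by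
  have e : 2 ^ j - 1 + 2 ^ (j + 1) * i + 1 = 2 ^ j * (2 * i + 1) := by
    have : 1 ≤ 2 ^ j := Nat.one_le_two_pow
    rw [pow_succ, mul_add, mul_one, ← mul_assoc]
    omega
  rw [e, padicValNat.mul (by positivity) (by omega), padicValNat.prime_pow,
    padicValNat.eq_zero_of_not_dvd (by omega), add_zero]

/-- At move `n` White works on the target whose index is the exponent of `2` in `n + 1`; every
target is thus served along an arithmetic progression of moves. -/
theorem isAlphaWinning_iInter_image_badOneOne (θ : ℕ → ℝ) (f : ℕ → (ℝ ≃ᵃ[ℝ] ℝ)) :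
    IsAlphaWinning (1 / 8 : ℝ) (⋂ j, f j '' BadOneOne (θ j)) := by
  intro β hβ hβ1
  choose move hmove hfar using fun j => exists_answer_far_from_fractions (θ j) (f j)
  set σ : WhiteStrategy ℝ := fun n B => move (padicValNat 2 (n + 1)) (B (Fin.last n)) with hσ
  have hplay : ∀ B n, σ.play B n = move (padicValNat 2 (n + 1)) (B n) := fun B n => by
    simp [hσ, WhiteStrategy.play]
  refine ⟨σ, fun B => ⟨fun n _ => hplay B n ▸ hmove _ _, fun hB x hx => ?_⟩⟩
  have hrad := radius_eq_of_legal (α := 1 / 8) (β := β) (fun n => hplay B n ▸ hmove _ _)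
    (fun n => hB (n + 1) n n.lt_succ_self)
  have hxW : ∀ n, x ∈ (move (padicValNat 2 (n + 1)) (B n)).toSet := fun n => by
    rw [← hplay]
    exact (Set.mem_iInter.mp hx n).2
  refine Set.mem_iInter.mpr fun j => ⟨(f j).symm x, ?_, (f j).apply_symm_apply x⟩
  set a := (f j).linear 1 with ha
  have ha0 : 0 < |a| := abs_pos.mpr (f j).real_linear_one_ne_zero
  set γ := 1 / 8 * β with hγ
  have hγ0 : 0 < γ := by positivity
  have hγ1 : γ < 1 := by rw [hγ]; linarith
  have hr0 := (B 0).radius_pos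
  obtain ⟨i₀, hi₀⟩ := exists_pow_lt_of_lt_one
    (show 0 < |a| / (4 * (B 0).radius) by positivity) hγ1
  rw [lt_div_iff₀ (by positivity)] at hi₀
  set time : ℕ → ℕ := fun i => 2 ^ j - 1 + 2 ^ (j + 1) * (i₀ + i) with htime
  have hsmall : ∀ i, 4 * (B (time i)).radius ≤ |a| := by
    intro i
    have hle : i₀ ≤ time i := by
      have : 1 ≤ 2 ^ (j + 1) := Nat.one_le_two_pow
      rw [htime]
      nlinarith
    have := pow_le_pow_of_le_one hγ0.le hγ1.le hle
    rw [hrad]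
    nlinarith
  refine mem_badOneOne_of_le_abs_sub_div (R := (γ ^ 2 ^ (j + 1))⁻¹)
    (T := fun i => |a| / (4 * (B (time i)).radius)) ?_ ?_ ?_ ?_
  · exact (one_lt_inv₀ (by positivity)).mpr (pow_lt_one₀ hγ0.le hγ1 (by positivity))
  · rw [le_div_iff₀ (by have := (B (time 0)).radius_pos; positivity), one_mul]
    exact hsmall 0
  · intro i
    have e : time (i + 1) = time i + 2 ^ (j + 1) := by simp only [htime]; ring
    have hpow : (B (time (i + 1))).radius = γ ^ 2 ^ (j + 1) * (B (time i)).radius := by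
      rw [hrad, hrad (time i), e, pow_add]
      ring
    rw [hpow]
    generalize γ ^ 2 ^ (j + 1) = u
    ring
  · intro i p
    have hr := (B (time i)).radius_pos
    have hx' := hxW (time i)
    rw [padicValNat_two_progression] at hx'
    have h := hfar j (B (time i)) (hsmall i) x hx' p
    rw [← ha] at h
    generalize dirichletDenom (θ j) (|a| / (4 * (B (time i)).radius)) = q at *
    have e : x - f j (p / q) = ((f j).symm x - p / q) * a := by
      conv_lhs => rw [← (f j).apply_symm_apply x]
      rw [(f j).real_apply_eq, (f j).real_apply_eq (p / q)]
      ring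
    rw [e, abs_mul, ← div_le_iff₀ ha0] at h
    refine le_trans (le_of_eq ?_) h
    field_simp
    norm_num

end SchmidtGame

namespace SchmidtGame

/-- The `d`-th of `N` equally spaced subintervals of `W`, each of relative length `1 / (2 N)`. -/
noncomputable def digitBall {N : ℕ} (W : GameBall ℝ) (d : Fin N) : GameBall ℝ where
  center := W.center + W.radius * ((2 * (d : ℝ) + 1) / N - 1)
  radius := 1 / (2 * N) * W.radius
  radius_pos := by
    have := W.radius_pos
    have : (0 : ℝ) < N := by exact_mod_cast d.pos
    positivity

theorem isAnswer_digitBall {N : ℕ} (W : GameBall ℝ) (d : Fin N) :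
    IsAnswer (1 / (2 * N)) W (digitBall W d) := by
  refine ⟨Metric.closedBall_subset_closedBall' ?_, rfl⟩
  have hr := W.radius_pos
  have hN : (0 : ℝ) < N := by exact_mod_cast d.pos
  have hd : (d : ℝ) + 1 ≤ N := by exact_mod_cast d.isLt
  have hd0 : (0 : ℝ) ≤ d := Nat.cast_nonneg _
  have h : |(2 * (d : ℝ) + 1) / N - 1| ≤ 1 - 1 / N := by
    rw [abs_le]
    constructor
    · have : 1 / (N : ℝ) ≤ (2 * (d : ℝ) + 1) / N := by gcongr; linarith
      linarith
    · have : (2 * (d : ℝ) + 1) / N ≤ (2 * N - 1) / N := by gcongr; linarith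
      have e : (2 * (N : ℝ) - 1) / N = 2 - 1 / N := by field_simp
      linarith
  have h2 : 1 / (2 * (N : ℝ)) ≤ 1 / N := by
    gcongr
    linarith
  simp only [digitBall, Real.dist_eq, add_sub_cancel_left, abs_mul, abs_of_pos hr]
  nlinarith

theorem le_abs_sub_of_mem_digitBall {N : ℕ} (W : GameBall ℝ) {d e : Fin N} (hde : d ≠ e)
    {x y : ℝ} (hx : x ∈ (digitBall W d).toSet) (hy : y ∈ (digitBall W e).toSet) :
    W.radius / N ≤ |x - y| := by
  have hr := W.radius_pos
  have hN : (0 : ℝ) < N := by exact_mod_cast d.pos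
  have h1 : (1 : ℝ) ≤ |(d : ℝ) - e| := by
    have h : ((d : ℕ) : ℤ) - (e : ℕ) ≠ 0 := by
      intro h
      exact hde (Fin.ext (by omega))
    exact_mod_cast Int.one_le_abs h
  have h2 : 2 * W.radius / N ≤ |(digitBall W d).center - (digitBall W e).center| := by
    have e : (digitBall W d).center - (digitBall W e).center =
        2 * W.radius / N * ((d : ℝ) - e) := by
      simp only [digitBall]
      ring
    rw [e, abs_mul, abs_of_pos (by positivity : 0 < 2 * W.radius / N)]
    exact le_mul_of_one_le_right (by positivity) h1
  have hx' : |x - (digitBall W d).center| ≤ 1 / (2 * N) * W.radius := hx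
  have hy' : |y - (digitBall W e).center| ≤ 1 / (2 * N) * W.radius := hy
  have h3 := abs_sub_le (digitBall W d).center x (digitBall W e).center
  have h4 := abs_sub_le x y (digitBall W e).center
  rw [abs_sub_comm (digitBall W d).center x] at h3
  have e1 : 1 / (2 * N) * W.radius + 1 / (2 * N) * W.radius = W.radius / N := by
    field_simp
    norm_num
  have e2 : 2 * W.radius / N = W.radius / N + W.radius / N := by ring
  linarith

/-- Black's first `n + 1` balls against `σ` when Black picks subintervals by the digits `d`. -/
noncomputable def digitHistory {N : ℕ} (σ : WhiteStrategy ℝ) (d : ℕ → Fin N) :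
    (n : ℕ) → Fin (n + 1) → GameBall ℝ
  | 0 => fun _ => ⟨0, 1, one_pos⟩
  | n + 1 => Fin.snoc (α := fun _ => GameBall ℝ) (digitHistory σ d n)
      (digitBall (σ n (digitHistory σ d n)) (d n))

/-- Black's play against `σ` given by the digits `d`. -/
noncomputable def digitPlay {N : ℕ} (σ : WhiteStrategy ℝ) (d : ℕ → Fin N) (n : ℕ) : GameBall ℝ :=
  digitHistory σ d n (Fin.last n)

theorem digitHistory_apply {N : ℕ} (σ : WhiteStrategy ℝ) (d : ℕ → Fin N) (n : ℕ)
    (i : Fin (n + 1)) : digitHistory σ d n i = digitPlay σ d i := by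
  induction n with
  | zero =>
    obtain rfl : i = Fin.last 0 := Fin.ext (by simp)
    rfl
  | succ n ih =>
    induction i using Fin.lastCases with
    | last => rfl
    | cast i =>
      rw [digitHistory, Fin.snoc_castSucc, ih]
      rfl

theorem play_digitPlay {N : ℕ} (σ : WhiteStrategy ℝ) (d : ℕ → Fin N) (n : ℕ) :
    σ.play (digitPlay σ d) n = σ n (digitHistory σ d n) := by
  rw [WhiteStrategy.play]
  congr 1
  funext i
  exact (digitHistory_apply σ d n i).symm

theorem digitPlay_succ {N : ℕ} (σ : WhiteStrategy ℝ) (d : ℕ → Fin N) (n : ℕ) :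
    digitPlay σ d (n + 1) = digitBall (σ.play (digitPlay σ d) n) (d n) := by
  rw [play_digitPlay, digitPlay, digitHistory, Fin.snoc_last]

theorem digitHistory_congr {N : ℕ} (σ : WhiteStrategy ℝ) {d e : ℕ → Fin N} {n : ℕ}
    (h : ∀ i < n, d i = e i) : digitHistory σ d n = digitHistory σ e n := by
  induction n with
  | zero => rfl
  | succ n ih =>
    rw [digitHistory, digitHistory, ih fun i hi => h i (by omega), h n n.lt_succ_self]

theorem blackLegalUpTo_digitPlay {N : ℕ} (σ : WhiteStrategy ℝ) (d : ℕ → Fin N) (n : ℕ) :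
    BlackLegalUpTo (1 / (2 * N)) σ (digitPlay σ d) n := by
  intro k _
  rw [digitPlay_succ]
  exact isAnswer_digitBall _ _

theorem nonempty_iInter_of_legal {α β : ℝ} {σ : WhiteStrategy ℝ} {B : ℕ → GameBall ℝ}
    (hW : ∀ n, IsAnswer α (B n) (σ.play B n)) (hB : ∀ n, IsAnswer β (σ.play B n) (B (n + 1))) :
    (⋂ n, (B n).toSet ∩ (σ.play B n).toSet).Nonempty := by
  have h := IsCompact.nonempty_iInter_of_sequence_nonempty_isCompact_isClosed
    (fun n => (σ.play B n).toSet) (fun n => (hW (n + 1)).1.trans (hB n).1)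
    (fun n => ⟨_, Metric.mem_closedBall_self (σ.play B n).radius_pos.le⟩)
    (isCompact_closedBall _ _) (fun n => Metric.isClosed_closedBall)
  obtain ⟨x, hx⟩ := h
  rw [Set.mem_iInter] at hx
  exact ⟨x, Set.mem_iInter.mpr fun n => ⟨(hW n).1 (hx n), hx n⟩⟩

/-- Lower bound for the dimension of an `(α, 1 / (2 N))`-winning set: Black's `N` choices at every
move embed a Cantor set whose digit map onto `[0, 1]` is Hölder continuous. -/
theorem IsAlphaBetaWinning.le_dimH {α : ℝ} (hα : 0 < α) (hα1 : α < 1) {N : ℕ} (hN : 1 < N)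
    {S : Set ℝ} (hS : IsAlphaBetaWinning α (1 / (2 * N)) S) :
    ENNReal.ofReal (Real.log N / Real.log (2 * N / α)) ≤ dimH S := by
  obtain ⟨σ, hσ⟩ := hS
  have hNr : (1 : ℝ) < N := by exact_mod_cast hN
  have hN0 : (0 : ℝ) < N := by linarith
  have hW : ∀ (d : ℕ → Fin N) n, IsAnswer α (digitPlay σ d n) (σ.play (digitPlay σ d) n) :=
    fun d n => (hσ _).1 n (blackLegalUpTo_digitPlay σ d n)
  have hB : ∀ (d : ℕ → Fin N) n,
      IsAnswer (1 / (2 * N)) (σ.play (digitPlay σ d) n) (digitPlay σ d (n + 1)) :=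
    fun d n => blackLegalUpTo_digitPlay σ d (n + 1) n n.lt_succ_self
  choose pt hpt using fun d : ℕ → Fin N => nonempty_iInter_of_legal (hW d) (hB d)
  have hptS : Set.range pt ⊆ S := by
    rintro _ ⟨d, rfl⟩
    exact (hσ _).2 (blackLegalUpTo_digitPlay σ d) (hpt d)
  set γ : ℝ := α * (1 / (2 * N)) with hγ
  have hγ0 : 0 < γ := by positivity
  have hsep : ∀ {d e : ℕ → Fin N} {n : ℕ}, (∀ i < n, d i = e i) → d n ≠ e n →
      γ ^ (n + 1) ≤ |pt d - pt e| := by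
    intro d e n h hne
    have hd := (Set.mem_iInter.mp (hpt d) (n + 1)).1
    have he := (Set.mem_iInter.mp (hpt e) (n + 1)).1
    rw [digitPlay_succ, play_digitPlay] at hd he
    rw [← digitHistory_congr σ h] at he
    have hs := le_abs_sub_of_mem_digitBall _ hne hd he
    have h0 : (digitPlay σ d 0).radius = 1 := rfl
    rw [← play_digitPlay σ d n, (hW d n).2, radius_eq_of_legal (hW d) (hB d), ← hγ, h0] at hs
    refine le_trans ?_ hs
    have e : α * (γ ^ n * 1) / N = 2 * γ ^ (n + 1) := by
      rw [pow_succ, hγ]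
      field_simp
    rw [e]
    linarith [pow_pos hγ0 (n + 1)]
  have hdiff : ∀ {d e : ℕ → Fin N}, d ≠ e → ∃ n, (∀ i < n, d i = e i) ∧ d n ≠ e n := by
    intro d e hde
    classical
    have hex : ∃ n, d n ≠ e n := Function.ne_iff.mp hde
    exact ⟨Nat.find hex, fun i hi => not_not.mp (Nat.find_min hex hi), Nat.find_spec hex⟩
  have hinj : Function.Injective pt := by
    intro d e hpe
    by_contra hde
    obtain ⟨n, h, hne⟩ := hdiff hde
    have := hsep h hne
    rw [hpe, sub_self, abs_zero] at this
    exact absurd this (not_le.mpr (by positivity))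
  have hγinv : 2 * N / α = γ⁻¹ := by
    rw [hγ]
    field_simp
  rw [hγinv]
  have hγ1 : 1 < γ⁻¹ := by
    rw [← hγinv, lt_div_iff₀ hα]
    linarith
  have hr : 0 < Real.log N / Real.log γ⁻¹ := div_pos (Real.log_pos hNr) (Real.log_pos hγ1)
  set r : ℝ := Real.log N / Real.log γ⁻¹ with hr_def
  have hγr : γ ^ r = (N : ℝ)⁻¹ := by
    have hlog : Real.log γ ≠ 0 := by
      have := Real.log_pos hγ1
      rw [Real.log_inv] at this
      linarith
    rw [Real.rpow_def_of_pos hγ0, hr_def, Real.log_inv, ← Real.exp_log (inv_pos.mpr hN0),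
      Real.log_inv]
    congr 1
    field_simp
  have : Nonempty (ℕ → Fin N) := ⟨fun _ => ⟨0, by omega⟩⟩
  set g : ℝ → ℝ := fun x => Real.ofDigits (Function.invFun pt x) with hg
  have hgpt : ∀ d, g (pt d) = Real.ofDigits d := fun d => by
    rw [hg]
    simp only [Function.leftInverse_invFun hinj d]
  have hholder : HolderOnWith (N : NNReal) r.toNNReal g (Set.range pt) := by
    rintro _ ⟨d, rfl⟩ _ ⟨e, rfl⟩
    rw [hgpt, hgpt]
    by_cases hde : d = e
    · simp [hde]
    obtain ⟨n, h, hne⟩ := hdiff hde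
    have h1 := Real.abs_ofDigits_sub_ofDigits_le h
    have h2 : ((N : ℝ) ^ n)⁻¹ ≤ N * |pt d - pt e| ^ r := by
      calc ((N : ℝ) ^ n)⁻¹ = N * ((N : ℝ)⁻¹) ^ (n + 1) := by
            rw [inv_pow, pow_succ]
            field_simp
        _ = N * (γ ^ (n + 1)) ^ r := by
            rw [← hγr, ← Real.rpow_natCast, ← Real.rpow_natCast, ← Real.rpow_mul hγ0.le,
              ← Real.rpow_mul hγ0.le, mul_comm r]
        _ ≤ N * |pt d - pt e| ^ r := by
            gcongr
            exact hsep h hne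
    rw [Real.coe_toNNReal _ hr.le, edist_dist, edist_dist, Real.dist_eq, Real.dist_eq,
      ENNReal.ofReal_rpow_of_nonneg (abs_nonneg _) hr.le]
    refine (ENNReal.ofReal_le_ofReal (h1.trans h2)).trans (le_of_eq ?_)
    rw [ENNReal.ofReal_mul hN0.le, ENNReal.ofReal_natCast]
    simp
  have himage : Set.Icc (0 : ℝ) 1 ⊆ g '' Set.range pt := by
    intro y hy
    obtain ⟨d, -, rfl⟩ := Real.ofDigits_SurjOn hN hy
    exact ⟨pt d, ⟨d, rfl⟩, hgpt d⟩
  have hIcc : dimH (Set.Icc (0 : ℝ) 1) = 1 := by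
    rw [Real.dimH_of_nonempty_interior (by simp [interior_Icc])]
    simp
  have h1 : 1 ≤ dimH (Set.range pt) / (r.toNNReal : ENNReal) :=
    hIcc ▸ (dimH_mono himage).trans (hholder.dimH_image_le (Real.toNNReal_pos.mpr hr))
  rw [ENNReal.le_div_iff_mul_le (Or.inl (by simpa using hr)) (Or.inl ENNReal.coe_ne_top),
    one_mul] at h1
  exact h1.trans (dimH_mono hptS)

theorem IsAlphaWinning.dimH_eq_one {α : ℝ} (hα : 0 < α) (hα1 : α < 1) {S : Set ℝ}
    (hS : IsAlphaWinning α S) : dimH S = 1 := by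
  refine le_antisymm ((dimH_mono (Set.subset_univ S)).trans (by simp [Real.dimH_univ])) ?_
  have hlim : Filter.Tendsto (fun N : ℕ => Real.log N / Real.log (2 * N / α)) Filter.atTop
      (nhds 1) := by
    have hlog : Filter.Tendsto (fun N : ℕ => Real.log N) Filter.atTop Filter.atTop :=
      Real.tendsto_log_atTop.comp tendsto_natCast_atTop_atTop
    have h1 : Filter.Tendsto (fun N : ℕ => 1 + Real.log (2 / α) / Real.log N) Filter.atTop
        (nhds (1 + 0)) := tendsto_const_nhds.add (hlog.const_div_atTop _)
    rw [add_zero] at h1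
    have h2 := h1.inv₀ one_ne_zero
    rw [inv_one] at h2
    refine h2.congr' ?_
    filter_upwards [Filter.eventually_gt_atTop 1] with N hN
    have hNr : (1 : ℝ) < N := by exact_mod_cast hN
    have hl := Real.log_pos hNr
    rw [show 2 * (N : ℝ) / α = N * (2 / α) by ring,
      Real.log_mul (by linarith) (by positivity), one_add_div hl.ne', inv_div]
  have hlim' := ENNReal.tendsto_ofReal hlim
  rw [ENNReal.ofReal_one] at hlim'
  refine le_of_tendsto hlim' ?_
  filter_upwards [Filter.eventually_gt_atTop 1] with N hN
  have hNr : (1 : ℝ) < N := by exact_mod_cast hN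
  refine IsAlphaBetaWinning.le_dimH hα hα1 hN (hS _ (by positivity) ?_)
  rw [div_lt_one (by positivity)]
  linarith

end SchmidtGame

theorem corollary2 {ι κ : Type*} [Countable ι] [Countable κ]
    (θ : ι → ℝ) (f : κ → (ℝ ≃ᵃ[ℝ] ℝ)) :
    SchmidtGame.IsAlphaWinning (1 / 8 : ℝ) (⋂ m : κ, ⋂ n : ι, f m '' BadOneOne (θ n)) ∧
      dimH (⋂ m : κ, ⋂ n : ι, f m '' BadOneOne (θ n)) = 1 := by
  have hwin : SchmidtGame.IsAlphaWinning (1 / 8 : ℝ)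
      (⋂ m : κ, ⋂ n : ι, f m '' BadOneOne (θ n)) := by
    obtain ⟨e, he⟩ : ∃ e : ℕ → Option (κ × ι), Function.Surjective e :=
      exists_surjective_nat _
    refine (SchmidtGame.isAlphaWinning_iInter_image_badOneOne
      (fun j => (e j).elim 0 fun mn => θ mn.2)
      (fun j => (e j).elim (AffineEquiv.refl ℝ ℝ) fun mn => f mn.1)).mono ?_
    intro x hx
    simp only [Set.mem_iInter] at hx ⊢
    intro m n
    obtain ⟨j, hj⟩ := he (some (m, n))
    simpa only [hj, Option.elim] using hx j
  exact ⟨hwin, hwin.dimH_eq_one (by norm_num) (by norm_num)⟩
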